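/- Let $\mathcal H$ be a complex Hilbert space. For a compact operator $X$ on $\mathcal H$, let $\mu_1^\downarrow(X)\ge\mu_2^\downarrow(X)\ge\cdots\ge 0$ be its singular values, i.e. the positive eigenvalues of $|X|=(X^*X)^{1/2}$, counted with multiplicity and arranged in nonincreasing order, followed by zeros if there are only finitely many of them. For $p>0$, let $S_p$ be the set of compact operators $X$ on $\mathcal H$ with $\sum_{k\ge1}\mu_k^\downarrow(X)^p<\infty$, and put $\|X\|_p=\bigl(\sum_{k\ge1}\mu_k^\downarrow(X)^p\bigr)^{1/p}$ for $X\in S_p$. For every $p>0$, the class $S_p$ is closed under addition. If $p\ge 2$, then for all $A,B,C\in S_p$ $$\|A+B\|_p^p+\|B+C\|_p^p+\|C+A\|_p^p\le 2^{p-2}\bigl(\|A+B+C\|_p^p+\|A\|_p^p+\|B\|_p^p+\|C\|_p^p\bigr).$$ If $0<p\le 2$, then the reversed inequality holds for all $A,B,C\in S_p$. For every $p>0$, equality holds, with both sides positive, whenever $A=B=-C\ne 0$ in $S_p$. Consequently the constant $2^{p-2}$ is optimal whenever $\mathcal H\ne\{0\}$: for $p\ge2$ it is the smallest real constant for which the inequality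 holds for all $A,B,C\in S_p$, and for $0<p\le2$ it is the largest real constant for which the reversed inequality holds for all $A,B,C\in S_p$. -/

import Mathlib

noncomputable section

variable {H : Type*} [NormedAddCommGroup H] [InnerProductSpace ℂ H] [CompleteSpace H]

/-- The sum of the eigenspaces of `|T| = (T* T)^{1/2}` for the eigenvalues `≥ t`. Eigenspaces for
different eigenvalues are independent, so its dimension is the number of eigenvalues `≥ t` of `|T|`,
counted with multiplicity. -/
def absEigenspaceGE (T : H →L[ℂ] H) (t : ℝ) : Submodule ℂ H :=
  ⨆ (r : ℝ) (_ : t ≤ r), Module.End.eigenspace ((CFC.abs T : H →L[ℂ] H) : H →ₗ[ℂ] H) (r : ℂ)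

/-- The `k`-th singular value (starting from `k = 0`) of a compact operator `T`: the `k`-th entry of
the list of the positive eigenvalues of `|T|`, counted with multiplicity, in nonincreasing order,
followed by zeros if there are only finitely many of them. It is the largest `t > 0` such that more
than `k` eigenvalues of `|T|` (with multiplicity) are `≥ t`, and `0` if there is no such `t`. -/
def singularValue (T : H →L[ℂ] H) (k : ℕ) : ℝ :=
  sSup {t : ℝ | 0 < t ∧ (k : Cardinal) < Module.rank ℂ (absEigenspaceGE T t)}

/-- The Schatten class `S_p`: the compact operators whose singular values are `p`-summable. -/
def schattenClass (H : Type*) [NormedAddCommGroup H] [InnerProductSpace ℂ H] [CompleteSpace H]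
    (p : ℝ) : Set (H →L[ℂ] H) :=
  {X | IsCompactOperator X ∧ Summable fun k : ℕ => singularValue X k ^ p}

/-- The Schatten `p`-(quasi)norm, meaningful for `p > 0` and `X` in `S_p`. -/
def schattenNorm (p : ℝ) (X : H →L[ℂ] H) : ℝ :=
  (∑' k : ℕ, singularValue X k ^ p) ^ (1 / p)

end

/-!
The eight operators in the inequality are linked by an orthogonal `4 × 4` matrix: the tuple
`(A + B, B + C, C + A, 0)` is `1/2` times a Hadamard matrix applied to `(A + B + C, A, B, -C)`. All
that is used of this is that `∑ ‖Y i x‖ ^ 2 = ∑ ‖X i x‖ ^ 2` for every vector `x`, that is,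
`∑ (Y i)* (Y i) = ∑ (X i)* (X i)` for the two tuples `Y` and `X`. The inequality holds for any two
finite families of compact operators in this relation (`sum_schattenSum_le`, `le_sum_schattenSum`).

Let `p ≥ 2`, and write `m k = ∑ ‖Y i (e k)‖ ^ 2` for the eigenvalues of `M = ∑ (Y i)* (Y i)` in a
Hilbert basis `e` of eigenvectors. In terms of traces of powers, with `N` the number of operators,
the proof is the chain
`∑ tr |Y i| ^ p ≤ tr M ^ (p/2) = ∑ₖ (∑ ‖X i (e k)‖ ^ 2) ^ (p/2)
  ≤ N ^ (p/2 - 1) ∑ ∑ₖ ‖X i (e k)‖ ^ p ≤ N ^ (p/2 - 1) ∑ tr |X i| ^ p`.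
The middle step is the power mean inequality. The two outer steps
(`IsGramEigenbasis.sum_tsum_le`, `IsSingularBasis.tsum_enorm_rpow_le`) are both instances of
Jensen's inequality for a doubly substochastic matrix (`ENNReal.tsum_rpow_tsum_mul_le`). For
`p ≤ 2` the power `p / 2` is concave and every step is reversed.

All sums of powers take values in `ℝ≥0∞`, so that summability enters only at the end: it is the
finiteness of `schattenSum`. The same inequality for `(A, A, B, B)` and `(A + B, A - B, 0, 0)`
shows that the Schatten classes are closed under addition. The link to the singular values is
`IsSingularBasis.tsum_singularValue_rpow`: if `e` is a Hilbert basis of eigenvectors of `T* T`,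
then the numbers `‖T (e k)‖` are the singular values of `T`, up to order and zeros.
-/

section

open scoped ENNReal InnerProductSpace InnerProduct
open Module.End ContinuousLinearMap

/-! ### Jensen's inequality for doubly substochastic matrices -/

/-- Jensen's inequality for `x ↦ x ^ q`. The weights need only have sum at most `1`, because the
function vanishes at `0`. -/
theorem ENNReal.rpow_tsum_mul_le_tsum_mul_rpow {ι : Type*} {w : ι → ℝ≥0∞} (hw : ∑' i, w i ≤ 1)
    (x : ι → ℝ≥0∞) {q : ℝ} (hq : 1 ≤ q) :
    (∑' i, w i * x i) ^ q ≤ ∑' i, w i * x i ^ q := by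
  have hq0 : 0 < q := by linarith
  rw [← ENNReal.le_rpow_inv_iff hq0]
  refine ENNReal.summable.tsum_le_of_sum_le fun s => ?_
  rw [ENNReal.le_rpow_inv_iff hq0]
  refine le_trans ?_ (ENNReal.sum_le_tsum s)
  have hs : ∑ i ∈ s, w i ≤ 1 := (ENNReal.sum_le_tsum s).trans hw
  -- One more point, of value `0`, takes up the missing weight.
  have := ENNReal.rpow_arith_mean_le_arith_mean_rpow (Finset.insertNone s)
    (fun o => o.elim (1 - ∑ i ∈ s, w i) w) (fun o => o.elim 0 x)
    (by simp [Finset.sum_insertNone, tsub_add_cancel_of_le hs]) hq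
  simpa [Finset.sum_insertNone, ENNReal.zero_rpow_of_pos hq0] using this

theorem ENNReal.tsum_mul_rpow_le_rpow_tsum_mul {ι : Type*} {w : ι → ℝ≥0∞} (hw : ∑' i, w i ≤ 1)
    (x : ι → ℝ≥0∞) {q : ℝ} (hq0 : 0 < q) (hq : q ≤ 1) :
    ∑' i, w i * x i ^ q ≤ (∑' i, w i * x i) ^ q := by
  rw [← ENNReal.rpow_inv_le_iff hq0]
  refine (ENNReal.rpow_tsum_mul_le_tsum_mul_rpow hw _ ((one_le_inv₀ hq0).2 hq)).trans_eq ?_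
  simp [ENNReal.rpow_rpow_inv hq0.ne']

theorem ENNReal.tsum_rpow_tsum_mul_le {ι κ : Type*} {w : ι → κ → ℝ≥0∞}
    (hrow : ∀ i, ∑' k, w i k ≤ 1) (hcol : ∀ k, ∑' i, w i k ≤ 1) (x : κ → ℝ≥0∞)
    {q : ℝ} (hq : 1 ≤ q) :
    ∑' i, (∑' k, w i k * x k) ^ q ≤ ∑' k, x k ^ q :=
  calc ∑' i, (∑' k, w i k * x k) ^ q
      ≤ ∑' i, ∑' k, w i k * x k ^ q :=
        ENNReal.tsum_le_tsum fun i => ENNReal.rpow_tsum_mul_le_tsum_mul_rpow (hrow i) x hq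
    _ = ∑' k, (∑' i, w i k) * x k ^ q := by
        rw [ENNReal.tsum_comm]; simp_rw [ENNReal.tsum_mul_right]
    _ ≤ ∑' k, x k ^ q := ENNReal.tsum_le_tsum fun k => mul_le_of_le_one_left' (hcol k)

/-- The concave counterpart of `ENNReal.tsum_rpow_tsum_mul_le`. Column sums are bounded below now,
but only in the columns that meet a nonzero entry of `x`. -/
theorem ENNReal.tsum_rpow_le_tsum_rpow_tsum_mul {ι κ : Type*} {w : ι → κ → ℝ≥0∞}
    (hrow : ∀ i, ∑' k, w i k ≤ 1) {x : κ → ℝ≥0∞} (hcol : ∀ k, x k ≠ 0 → 1 ≤ ∑' i, w i k)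
    {q : ℝ} (hq0 : 0 < q) (hq : q ≤ 1) :
    ∑' k, x k ^ q ≤ ∑' i, (∑' k, w i k * x k) ^ q :=
  calc ∑' k, x k ^ q ≤ ∑' k, (∑' i, w i k) * x k ^ q := by
        refine ENNReal.tsum_le_tsum fun k => ?_
        by_cases hx : x k = 0
        · simp [hx, ENNReal.zero_rpow_of_pos hq0]
        · exact le_mul_of_one_le_left' (hcol k hx)
    _ = ∑' i, ∑' k, w i k * x k ^ q := by
        rw [ENNReal.tsum_comm]; simp_rw [ENNReal.tsum_mul_right]
    _ ≤ ∑' i, (∑' k, w i k * x k) ^ q :=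
        ENNReal.tsum_le_tsum fun i => ENNReal.tsum_mul_rpow_le_rpow_tsum_mul (hrow i) x hq0 hq

theorem ENNReal.sum_rpow_le_const_mul_rpow_sum {ι : Type*} (s : Finset ι) (hs : s.Nonempty)
    (x : ι → ℝ≥0∞) {q : ℝ} (hq0 : 0 < q) (hq : q ≤ 1) :
    (s.card : ℝ≥0∞) ^ (q - 1) * ∑ i ∈ s, x i ^ q ≤ (∑ i ∈ s, x i) ^ q := by
  have hc : (s.card : ℝ≥0∞) ≠ 0 := by simpa using hs.ne_empty
  have h := ENNReal.rpow_sum_le_const_mul_sum_rpow s (fun i => x i ^ q)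
    ((one_le_inv₀ hq0).2 hq)
  simp only [ENNReal.rpow_rpow_inv hq0.ne'] at h
  rw [ENNReal.rpow_inv_le_iff hq0, ENNReal.mul_rpow_of_nonneg _ _ hq0.le, ← ENNReal.rpow_mul,
    sub_mul, inv_mul_cancel₀ hq0.ne', one_mul] at h
  calc _ ≤ (s.card : ℝ≥0∞) ^ (q - 1) * ((s.card : ℝ≥0∞) ^ (1 - q) * (∑ i ∈ s, x i) ^ q) := by
        gcongr
    _ = _ := by
      rw [← mul_assoc, ← ENNReal.rpow_add _ _ hc (by simp)]
      simp

theorem enorm_sq_eq_ofReal {E : Type*} [SeminormedAddCommGroup E] (x : E) :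
    ‖x‖ₑ ^ 2 = ENNReal.ofReal (‖x‖ ^ 2) := by
  rw [ENNReal.ofReal_pow (norm_nonneg _), ofReal_norm]

theorem HilbertBasis.enorm_apply {κ 𝕜 E : Type*} [RCLike 𝕜] [NormedAddCommGroup E]
    [InnerProductSpace 𝕜 E] (e : HilbertBasis κ 𝕜 E) (k : κ) : ‖e k‖ₑ = 1 := by
  rw [← ofReal_norm, e.orthonormal.1, ENNReal.ofReal_one]

theorem ENNReal.sq_rpow_half (x : ℝ≥0∞) (p : ℝ) : (x ^ 2) ^ (p / 2) = x ^ p := by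
  rw [← ENNReal.rpow_natCast, ← ENNReal.rpow_mul]
  congr 1; push_cast; ring

/-- The numerical end of the Cauchy-Schwarz argument in `IsGramEigenbasis.sum_div_le_one`. -/
theorem sq_mul_le_one_of_sq_mul_le_mul {s R y : ℝ} (h : s ^ 2 * R ≤ s * y) (hR : 0 ≤ R)
    (hy : y ^ 2 ≤ R) : s ^ 2 * R ≤ 1 := by
  have h1 : (s ^ 2 * R) ^ 2 ≤ s ^ 2 * R :=
    calc (s ^ 2 * R) ^ 2 ≤ (s * y) ^ 2 := pow_le_pow_left₀ (by positivity) h 2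
      _ = s ^ 2 * y ^ 2 := by ring
      _ ≤ s ^ 2 * R := mul_le_mul_of_nonneg_left hy (sq_nonneg s)
  by_contra! hlt
  generalize s ^ 2 * R = x at h1 hlt
  nlinarith

/-! ### Diagonalization and singular values -/

variable {H : Type*} [NormedAddCommGroup H] [InnerProductSpace ℂ H] [CompleteSpace H]

theorem ContinuousLinearMap.exists_hilbertBasis_eigenvectors {M : H →L[ℂ] H}
    (hM : IsCompactOperator M) (hM' : M.IsSymmetric) :
    ∃ (κ : Set H) (e : HilbertBasis κ ℂ H), ∀ k, ∃ μ : ℂ, M (e k) = μ • e k := by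
  choose w b hb using fun μ : ℂ => exists_hilbertBasis ℂ (eigenspace (M : H →ₗ[ℂ] H) μ)
  have ho := hM'.orthogonalFamily_eigenspaces.orthonormal_sigma_orthonormal
    (fun μ => (b μ).orthonormal)
  have ho' := ho.toSubtypeRange
  refine ⟨_, HilbertBasis.mkOfOrthogonalEqBot ho' ?_, ?_⟩
  · rw [Subtype.range_coe, eq_bot_iff, ← M.orthogonalComplement_iSup_eigenspaces_eq_bot hM hM']
    rw [← Submodule.orthogonal_closure (Submodule.span _ _)]
    refine Submodule.orthogonal_le (iSup_le fun μ => ?_)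
    intro x hx
    have h1 := (b μ).hasSum_repr ⟨x, hx⟩
    have h2 := h1.mapL (eigenspace (M : H →ₗ[ℂ] H) μ).subtypeL
    refine mem_closure_of_tendsto h2 (Filter.Eventually.of_forall fun s => ?_)
    refine Submodule.sum_mem _ fun i _ => ?_
    rw [map_smul]
    exact Submodule.smul_mem _ _ (Submodule.subset_span ⟨⟨μ, i⟩, rfl⟩)
  · rintro ⟨_, ⟨⟨μ, i⟩, rfl⟩⟩
    refine ⟨μ, ?_⟩
    rw [HilbertBasis.coe_mkOfOrthogonalEqBot]
    exact mem_eigenspace_iff.1 (b μ i).2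

/-- `e` is a basis of eigenvectors of `∑ i, (Y i)* (Y i)`; the eigenvalue at `e k` is then
necessarily `∑ i, ‖Y i (e k)‖ ^ 2`. -/
def IsGramEigenbasis {ι κ : Type*} [Fintype ι] (Y : ι → H →L[ℂ] H) (e : HilbertBasis κ ℂ H) :
    Prop :=
  ∀ k, ∑ i, adjoint (Y i) (Y i (e k)) = ((∑ i, ‖Y i (e k)‖ ^ 2 : ℝ) : ℂ) • e k

/-- `e` is a basis of eigenvectors of `T* T`; the eigenvalue at `e k` is then necessarily
`‖T (e k)‖ ^ 2`, so that `‖T (e k)‖` runs through the singular values of `T`. -/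
def IsSingularBasis {κ : Type*} (T : H →L[ℂ] H) (e : HilbertBasis κ ℂ H) : Prop :=
  ∀ k, adjoint T (T (e k)) = ((‖T (e k)‖ ^ 2 : ℝ) : ℂ) • e k

theorem exists_isGramEigenbasis {ι : Type*} [Fintype ι] {Y : ι → H →L[ℂ] H}
    (hY : ∀ i, IsCompactOperator (Y i)) :
    ∃ (κ : Set H) (e : HilbertBasis κ ℂ H), IsGramEigenbasis Y e := by
  set M : H →L[ℂ] H := ∑ i, adjoint (Y i) ∘L Y i with hM
  have hMx : ∀ x, M x = ∑ i, adjoint (Y i) (Y i x) := fun x => by simp [hM]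
  have hMc : IsCompactOperator M := by
    have h : M ∈ compactOperator (RingHom.id ℂ) H H :=
      Submodule.sum_mem _ fun i _ => (hY i).clm_comp (adjoint (Y i))
    exact h
  obtain ⟨κ, e, he⟩ := exists_hilbertBasis_eigenvectors hMc (fun x y => by
    simp [hM, sum_inner, inner_sum, adjoint_inner_left, adjoint_inner_right])
  refine ⟨κ, e, fun k => ?_⟩
  obtain ⟨μ, hμ⟩ := he k
  have h1 : ⟪e k, M (e k)⟫_ℂ = μ := by
    rw [hμ, inner_smul_right, inner_self_eq_norm_sq_to_K, e.orthonormal.1]; simp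
  rw [← hMx, hμ, ← h1, hMx, inner_sum]
  simp only [adjoint_inner_right, inner_self_eq_norm_sq_to_K]
  push_cast
  rfl

theorem exists_isSingularBasis {T : H →L[ℂ] H} (hT : IsCompactOperator T) :
    ∃ (κ : Set H) (e : HilbertBasis κ ℂ H), IsSingularBasis T e := by
  obtain ⟨κ, e, he⟩ := exists_isGramEigenbasis (Y := fun _ : Unit => T) fun _ => hT
  exact ⟨κ, e, fun k => by simpa using he k⟩

/-- An eigenvector of `|T| ^ 2 = T* T` is an eigenvector of `|T|`, because `|T| ≥ 0`. -/
theorem IsSingularBasis.cfcAbs_apply {κ : Type*} {T : H →L[ℂ] H} {e : HilbertBasis κ ℂ H}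
    (he : IsSingularBasis T e) (k : κ) :
    (CFC.abs T : H →L[ℂ] H) (e k) = (‖T (e k)‖ : ℂ) • e k := by
  set P : H →L[ℂ] H := CFC.abs T with hP
  set s : ℝ := ‖T (e k)‖ with hs
  have hpos : P.IsPositive := by
    rw [← ContinuousLinearMap.nonneg_iff_isPositive]; exact CFC.abs_nonneg T
  have hsq : ∀ x, P (P x) = adjoint T (T x) := fun x => by
    have := CFC.abs_mul_abs T
    exact congrArg (fun S : H →L[ℂ] H => S x) this
  -- `v` would be an eigenvector of `P ≥ 0` for the eigenvalue `-s`.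
  set v := P (e k) - (s : ℂ) • e k with hv
  have hPv : P v = -(s : ℂ) • v := by
    rw [hv, map_sub, hsq, he k, map_smul, ← hs, smul_sub, smul_smul]
    push_cast
    module
  have h1 : 0 ≤ (⟪P v, v⟫_ℂ).re := hpos.re_inner_nonneg_left v
  have h2 : (⟪P v, v⟫_ℂ).re = -(s * ‖v‖ ^ 2) := by
    rw [hPv, inner_smul_left, inner_self_eq_norm_sq_to_K]
    simp [← Complex.ofReal_pow]
  have h0 : 0 ≤ s := norm_nonneg _
  suffices v = 0 from sub_eq_zero.1 this
  -- For `s = 0` the eigenvalue is no contradiction; then `P (P (e k)) = 0` forces `P (e k) = 0`.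
  rcases h0.eq_or_lt with hs0 | hs0
  · have h3 : ⟪P v, e k⟫_ℂ = 0 := by rw [hPv, ← hs0]; simp
    have hv' : v = P (e k) := by rw [hv, ← hs0]; simp
    have h4 : ⟪v, v⟫_ℂ = ⟪P v, e k⟫_ℂ := by
      conv_lhs => rw [hv']
      rw [hv']
      exact (hpos.isSymmetric (P (e k)) (e k)).symm
    rw [h3] at h4
    exact inner_self_eq_zero.1 h4
  · have : ‖v‖ ^ 2 = 0 := by nlinarith [sq_nonneg ‖v‖, mul_nonneg hs0.le (sq_nonneg ‖v‖)]
    simpa using this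

theorem IsSingularBasis.inner_eq {κ : Type*} {T : H →L[ℂ] H} {e : HilbertBasis κ ℂ H}
    (he : IsSingularBasis T e) (k : κ) (x : H) :
    ⟪T (e k), T x⟫_ℂ = ((‖T (e k)‖ ^ 2 : ℝ) : ℂ) * ⟪e k, x⟫_ℂ := by
  rw [← ContinuousLinearMap.adjoint_inner_left, he k, inner_smul_left]
  simp

/-- The vectors `T (e k)` are pairwise orthogonal, so infinitely many of norm at least `t` would
form a sequence in a compact set without a convergent subsequence. -/
theorem IsSingularBasis.finite_le_norm {κ : Type*} {T : H →L[ℂ] H} {e : HilbertBasis κ ℂ H}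
    (he : IsSingularBasis T e) (hT : IsCompactOperator T) {t : ℝ} (ht : 0 < t) :
    {k | t ≤ ‖T (e k)‖}.Finite := by
  by_contra hinf
  let f := Set.Infinite.natEmbedding _ hinf
  have hK := hT.isCompact_closure_image_closedBall (r := 1)
  obtain ⟨a, -, φ, hφ, hlim⟩ := hK.tendsto_subseq (x := fun n => T (e (f n)))
    (fun n => subset_closure ⟨e (f n), by simp [e.orthonormal.1], rfl⟩)
  have hC := hlim.cauchySeq
  obtain ⟨N, hN⟩ := Metric.cauchySeq_iff.1 hC t ht
  have h := hN N le_rfl (N + 1) (Nat.le_succ N)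
  have hne : (f (φ N) : κ) ≠ f (φ (N + 1)) := fun h =>
    (hφ (Nat.lt_succ_self N)).ne (f.injective (Subtype.ext h))
  have hz : ⟪T (e (f (φ N))), T (e (f (φ (N + 1))))⟫_ℂ = 0 := by
    rw [he.inner_eq, e.orthonormal.2 hne, mul_zero]
  have h2 := @norm_sub_sq ℂ _ _ _ _ (T (e (f (φ N)))) (T (e (f (φ (N + 1)))))
  rw [hz] at h2
  simp only [Function.comp, dist_eq_norm] at h
  have h3 : t ≤ ‖T (e (f (φ N)))‖ := (f (φ N)).2
  simp only [map_zero, mul_zero, sub_zero] at h2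
  nlinarith [norm_nonneg (T (e (f (φ N))) - T (e (f (φ (N + 1))))),
    sq_nonneg ‖T (e (f (φ (N + 1))))‖]

theorem IsSingularBasis.absEigenspaceGE_eq {κ : Type*} {T : H →L[ℂ] H} {e : HilbertBasis κ ℂ H}
    (he : IsSingularBasis T e) (hT : IsCompactOperator T) {t : ℝ} (ht : 0 < t) :
    absEigenspaceGE T t = Submodule.span ℂ (e '' {k | t ≤ ‖T (e k)‖}) := by
  have hpos : (CFC.abs T : H →L[ℂ] H).IsPositive := by
    rw [← ContinuousLinearMap.nonneg_iff_isPositive]; exact CFC.abs_nonneg T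
  refine le_antisymm (iSup₂_le fun r hr v hv => ?_) (Submodule.span_le.2 ?_)
  · have hv' : (CFC.abs T : H →L[ℂ] H) v = (r : ℂ) • v := mem_eigenspace_iff.1 hv
    have hz : ∀ k, ¬ t ≤ ‖T (e k)‖ → ⟪e k, v⟫_ℂ = 0 := fun k hk => by
      have h1 : ⟪(CFC.abs T : H →L[ℂ] H) (e k), v⟫_ℂ = ⟪e k, (CFC.abs T : H →L[ℂ] H) v⟫_ℂ :=
        hpos.isSymmetric _ _
      rw [he.cfcAbs_apply, hv', inner_smul_left, inner_smul_right, Complex.conj_ofReal] at h1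
      by_contra hne
      have := mul_right_cancel₀ hne h1
      rw [Complex.ofReal_inj] at this
      exact hk (this ▸ hr)
    have hf := he.finite_le_norm hT ht
    have h1 := e.hasSum_repr v
    have h2 : HasSum (fun i => e.repr v i • e i) (∑ i ∈ hf.toFinset, e.repr v i • e i) :=
      hasSum_sum_of_ne_finset_zero fun k hk => by
        rw [e.repr_apply_apply, hz k (by simpa using hk), zero_smul]
    rw [h1.unique h2]
    refine Submodule.sum_mem _ fun i hi => Submodule.smul_mem _ _ (Submodule.subset_span ?_)
    exact ⟨i, by simpa using hi, rfl⟩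
  · rintro _ ⟨k, hk, rfl⟩
    refine Submodule.mem_iSup_of_mem ‖T (e k)‖ (Submodule.mem_iSup_of_mem hk ?_)
    exact mem_eigenspace_iff.2 (he.cfcAbs_apply k)

theorem IsSingularBasis.rank_absEigenspaceGE {κ : Type*} {T : H →L[ℂ] H} {e : HilbertBasis κ ℂ H}
    (he : IsSingularBasis T e) (hT : IsCompactOperator T) {t : ℝ} (ht : 0 < t) :
    Module.rank ℂ (absEigenspaceGE T t) = ({k | t ≤ ‖T (e k)‖}.ncard : Cardinal) := by
  rw [he.absEigenspaceGE_eq hT ht,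
    ← Set.ncard_image_of_injective _ e.orthonormal.linearIndependent.injective,
    rank_span_set]
  · rw [← Set.cast_ncard ((he.finite_le_norm hT ht).image e)]
  · exact LinearIndepOn.id_image (e.orthonormal.linearIndependent.linearIndepOn _)

theorem IsSingularBasis.lt_singularValue_iff {κ : Type*} {T : H →L[ℂ] H} {e : HilbertBasis κ ℂ H}
    (he : IsSingularBasis T e) (hT : IsCompactOperator T) {s : ℝ} (hs : 0 < s) (n : ℕ) :
    s < singularValue T n ↔ n < {k | s < ‖T (e k)‖}.ncard := by
  have hfin : {k | s < ‖T (e k)‖}.Finite :=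
    (he.finite_le_norm hT hs).subset fun k hk => show s ≤ ‖T (e k)‖ from le_of_lt hk
  have hset : {t : ℝ | 0 < t ∧ (n : Cardinal) < Module.rank ℂ (absEigenspaceGE T t)} =
      {t : ℝ | 0 < t ∧ n < {k | t ≤ ‖T (e k)‖}.ncard} := by
    ext t
    refine and_congr_right fun ht => ?_
    rw [he.rank_absEigenspaceGE hT ht, Nat.cast_lt]
  unfold singularValue
  rw [hset]
  constructor
  · intro h
    obtain ⟨t, ⟨ht, hn⟩, hst⟩ := exists_lt_of_lt_csSup
      (Set.nonempty_iff_ne_empty.2 fun h0 => by rw [h0, Real.sSup_empty] at h; linarith) h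
    exact hn.trans_le (Set.ncard_le_ncard (fun k hk => hst.trans_le hk) hfin)
  · intro h
    have hne : hfin.toFinset.Nonempty := by
      rw [← Finset.card_pos, ← Set.ncard_eq_toFinset_card _ hfin]; omega
    obtain ⟨k₀, hk₀, hmin⟩ := hfin.toFinset.exists_min_image (fun k => ‖T (e k)‖) hne
    simp only [Set.Finite.mem_toFinset, Set.mem_ofPred_eq] at hk₀ hmin
    refine hk₀.trans_le (le_csSup ⟨‖T‖, ?_⟩ ⟨hs.trans hk₀, ?_⟩)
    · rintro t ⟨ht, hn⟩
      obtain ⟨k, hk⟩ := (Set.ncard_pos (he.finite_le_norm hT ht)).1 (by omega)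
      exact le_trans hk ((T.le_opNorm _).trans (by simp [e.orthonormal.1]))
    · exact h.trans_le (Set.ncard_le_ncard hmin
        (he.finite_le_norm hT (hs.trans hk₀)))

theorem singularValue_nonneg (T : H →L[ℂ] H) (n : ℕ) : 0 ≤ singularValue T n :=
  Real.sSup_nonneg fun _ h => h.1.le

/-- The singular values and the numbers `‖T (e k)‖` have the same distribution function, so the
layer cake formula for the two counting measures gives the same sum of `p`-th powers. -/
theorem IsSingularBasis.tsum_singularValue_rpow {κ : Type*} {T : H →L[ℂ] H}
    {e : HilbertBasis κ ℂ H} (he : IsSingularBasis T e) (hT : IsCompactOperator T) {p : ℝ}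
    (hp : 0 < p) :
    ∑' n, ENNReal.ofReal (singularValue T n ^ p) = ∑' k, ‖T (e k)‖ₑ ^ p := by
  let : MeasurableSpace κ := ⊤
  have h1 := MeasureTheory.lintegral_rpow_eq_lintegral_meas_lt_mul
    (MeasureTheory.Measure.count (α := ℕ)) (f := fun n => singularValue T n)
    (Filter.Eventually.of_forall (singularValue_nonneg T))
    (measurable_of_countable _).aemeasurable hp
  have h2 := MeasureTheory.lintegral_rpow_eq_lintegral_meas_lt_mul
    (MeasureTheory.Measure.count (α := κ)) (f := fun k => ‖T (e k)‖)
    (Filter.Eventually.of_forall fun _ => norm_nonneg _) measurable_from_top.aemeasurable hp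
  rw [MeasureTheory.lintegral_count] at h1
  rw [MeasureTheory.lintegral_count' measurable_from_top] at h2
  have h3 : ∀ k, ENNReal.ofReal (‖T (e k)‖ ^ p) = ‖T (e k)‖ₑ ^ p := fun k => by
    rw [← ENNReal.ofReal_rpow_of_nonneg (norm_nonneg _) hp.le, ofReal_norm]
  simp_rw [h3] at h2
  rw [h1, h2]
  congr 1
  refine MeasureTheory.setLIntegral_congr_fun measurableSet_Ioi fun s hs => ?_
  have hfin : {k | s < ‖T (e k)‖}.Finite :=
    (he.finite_le_norm hT hs).subset fun k hk => show s ≤ ‖T (e k)‖ from le_of_lt hk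
  simp only [he.lt_singularValue_iff hT hs]
  rw [MeasureTheory.Measure.count_apply (Set.to_countable _).measurableSet,
    MeasureTheory.Measure.count_apply (by trivial), ← hfin.cast_ncard_eq,
    show {a : ℕ | a < {k | s < ‖T (e k)‖}.ncard} = ↑(Finset.range {k | s < ‖T (e k)‖}.ncard) by
      ext; simp, Set.encard_coe_eq_coe_finsetCard]
  simp

/-! ### Sums of powers in an arbitrary Hilbert basis -/

/-- The quadratic form of `T* T` in its eigenbasis `f`. -/
theorem IsSingularBasis.tsum_enorm_sq_mul {κ : Type*} {T : H →L[ℂ] H} {f : HilbertBasis κ ℂ H}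
    (hf : IsSingularBasis T f) (x : H) :
    ∑' l, ‖T (f l)‖ₑ ^ 2 * ‖⟪f l, x⟫_ℂ‖ₑ ^ 2 = ‖T x‖ₑ ^ 2 := by
  have h := f.hasSum_inner_mul_inner (adjoint T (T x)) x
  have hterm : ∀ l, ⟪adjoint T (T x), f l⟫_ℂ * ⟪f l, x⟫_ℂ =
      ((‖T (f l)‖ ^ 2 * ‖⟪f l, x⟫_ℂ‖ ^ 2 : ℝ) : ℂ) := fun l => by
    rw [adjoint_inner_left, ← inner_conj_symm, hf.inner_eq, map_mul, Complex.conj_ofReal, mul_assoc,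
      Complex.conj_mul']
    push_cast; rfl
  have hsum : ⟪adjoint T (T x), x⟫_ℂ = ((‖T x‖ ^ 2 : ℝ) : ℂ) := by
    rw [adjoint_inner_left, inner_self_eq_norm_sq_to_K]; push_cast; rfl
  simp only [hterm, hsum] at h
  have h2 := Complex.hasSum_ofReal.1 h
  have h3 := ENNReal.ofReal_tsum_of_nonneg (fun l => by positivity) h2.summable
  rw [h2.tsum_eq] at h3
  simp only [ENNReal.ofReal_mul (sq_nonneg _), ENNReal.ofReal_pow (norm_nonneg _),
    ofReal_norm] at h3
  exact h3.symm

theorem HilbertBasis.tsum_enorm_inner_sq {κ : Type*} (e : HilbertBasis κ ℂ H) (x : H) :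
    ∑' k, ‖⟪e k, x⟫_ℂ‖ₑ ^ 2 = ‖x‖ₑ ^ 2 := by
  have h1 : ∀ k, ‖e k‖ = 1 := e.orthonormal.1
  have h : IsSingularBasis (ContinuousLinearMap.id ℂ H) e := fun k => by
    simp [← star_eq_adjoint, ← ContinuousLinearMap.one_def, h1]
  have h2 : ∀ k, ‖e k‖ₑ = 1 := fun k => by rw [← ofReal_norm, h1, ENNReal.ofReal_one]
  simpa [h2] using h.tsum_enorm_sq_mul x

theorem HilbertBasis.tsum_enorm_inner_sq_right {κ : Type*} (e : HilbertBasis κ ℂ H) (x : H) :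
    ∑' k, ‖⟪x, e k⟫_ℂ‖ₑ ^ 2 = ‖x‖ₑ ^ 2 := by
  rw [← e.tsum_enorm_inner_sq x]
  refine tsum_congr fun k => ?_
  rw [← ofReal_norm, norm_inner_symm, ofReal_norm]

/-- The matrix `‖⟪f l, e k⟫‖ ^ 2` is doubly stochastic and takes the eigenvalues of `T* T` to its
diagonal in the basis `e`. -/
theorem IsSingularBasis.tsum_enorm_rpow_le {κ κ' : Type*} {T : H →L[ℂ] H} {f : HilbertBasis κ ℂ H}
    (hf : IsSingularBasis T f) (e : HilbertBasis κ' ℂ H) {p : ℝ} (hp : 2 ≤ p) :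
    ∑' k, ‖T (e k)‖ₑ ^ p ≤ ∑' l, ‖T (f l)‖ₑ ^ p := by
  have h := ENNReal.tsum_rpow_tsum_mul_le (w := fun k l => ‖⟪f l, e k⟫_ℂ‖ₑ ^ 2)
    (fun k => by rw [f.tsum_enorm_inner_sq, e.enorm_apply, one_pow])
    (fun l => by rw [e.tsum_enorm_inner_sq_right, f.enorm_apply, one_pow])
    (fun l => ‖T (f l)‖ₑ ^ 2) (q := p / 2) (by linarith)
  simpa only [mul_comm, hf.tsum_enorm_sq_mul, ENNReal.sq_rpow_half] using h

/-- The concave counterpart of `IsSingularBasis.tsum_enorm_rpow_le`. -/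
theorem IsSingularBasis.le_tsum_enorm_rpow {κ κ' : Type*} {T : H →L[ℂ] H} {f : HilbertBasis κ ℂ H}
    (hf : IsSingularBasis T f) (e : HilbertBasis κ' ℂ H) {p : ℝ} (hp0 : 0 < p) (hp : p ≤ 2) :
    ∑' l, ‖T (f l)‖ₑ ^ p ≤ ∑' k, ‖T (e k)‖ₑ ^ p := by
  have h := ENNReal.tsum_rpow_le_tsum_rpow_tsum_mul (w := fun k l => ‖⟪f l, e k⟫_ℂ‖ₑ ^ 2)
    (fun k => by rw [f.tsum_enorm_inner_sq, e.enorm_apply, one_pow])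
    (x := fun l => ‖T (f l)‖ₑ ^ 2)
    (fun l _ => by rw [e.tsum_enorm_inner_sq_right, f.enorm_apply, one_pow])
    (q := p / 2) (by linarith) (by linarith)
  simpa only [mul_comm, hf.tsum_enorm_sq_mul, ENNReal.sq_rpow_half] using h

/-! ### Sums of powers for a family of operators -/

section Gram

variable {ι κ : Type*} [Fintype ι] {Y : ι → H →L[ℂ] H} {e : HilbertBasis κ ℂ H}

/-- The quadratic form of `M = ∑ (Y i)* (Y i)` on finite combinations of its eigenvectors. -/
theorem IsGramEigenbasis.sum_norm_sq_sum_smul (he : IsGramEigenbasis Y e) (K : Finset κ)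
    (a : κ → ℂ) :
    ∑ i, ‖Y i (∑ k ∈ K, a k • e k)‖ ^ 2 = ∑ k ∈ K, ‖a k‖ ^ 2 * ∑ i, ‖Y i (e k)‖ ^ 2 := by
  set v := ∑ k ∈ K, a k • e k with hv
  have h1 : ∑ i, adjoint (Y i) (Y i v) =
      ∑ k ∈ K, (a k * ((∑ i, ‖Y i (e k)‖ ^ 2 : ℝ) : ℂ)) • e k := by
    simp only [hv, map_sum, map_smul]
    rw [Finset.sum_comm]
    refine Finset.sum_congr rfl fun k _ => ?_
    rw [← Finset.smul_sum, he k, smul_smul]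
  have h2 : ⟪v, ∑ i, adjoint (Y i) (Y i v)⟫_ℂ = ((∑ i, ‖Y i v‖ ^ 2 : ℝ) : ℂ) := by
    simp only [inner_sum, adjoint_inner_right, inner_self_eq_norm_sq_to_K]
    push_cast; rfl
  rw [h1, hv, e.orthonormal.inner_sum, ← hv] at h2
  rw [← Complex.ofReal_inj, ← h2, Complex.ofReal_sum]
  refine Finset.sum_congr rfl fun k _ => ?_
  rw [← mul_assoc, Complex.conj_mul', Complex.ofReal_mul, Complex.ofReal_pow]

/-- A bound for `‖Y i (f l)‖ ^ 2 * ⟪M⁻¹ (f l), f l⟫`, where `M = ∑ (Y j)* (Y j) ≥ (Y i)* (Y i)`,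
with `M⁻¹` truncated to the span of finitely many eigenvectors `e k`. Where `M (e k) = 0`, the
convention `x / 0 = 0` drops the term, and its numerator is `0` as well. -/
theorem IsGramEigenbasis.sum_div_le_one (he : IsGramEigenbasis Y e) (i : ι)
    {κ' : Type*} {f : HilbertBasis κ' ℂ H} (hf : IsSingularBasis (Y i) f) (l : κ') (K : Finset κ) :
    ∑ k ∈ K, ‖Y i (f l)‖ ^ 2 * ‖⟪f l, e k⟫_ℂ‖ ^ 2 / ∑ j, ‖Y j (e k)‖ ^ 2 ≤ 1 := by
  set m : κ → ℝ := fun k => ∑ j, ‖Y j (e k)‖ ^ 2 with hm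
  set R : ℝ := ∑ k ∈ K, ‖⟪f l, e k⟫_ℂ‖ ^ 2 / m k with hR
  have hm0 : ∀ k, 0 ≤ m k := fun k => Finset.sum_nonneg fun _ _ => sq_nonneg _
  have hR0 : 0 ≤ R := Finset.sum_nonneg fun k _ => div_nonneg (sq_nonneg _) (hm0 k)
  have hgoal : ∑ k ∈ K, ‖Y i (f l)‖ ^ 2 * ‖⟪f l, e k⟫_ℂ‖ ^ 2 / m k = ‖Y i (f l)‖ ^ 2 * R := by
    rw [hR, Finset.mul_sum]
    simp only [mul_div_assoc]
  rw [hgoal]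
  -- `v` is the truncation of `M⁻¹ (f l)`, so that `⟪f l, v⟫ = ⟪v, M v⟫ = R`.
  set a : κ → ℂ := fun k => ⟪e k, f l⟫_ℂ / (m k : ℂ) with ha
  set v := ∑ k ∈ K, a k • e k with hv
  have h1 : ⟪f l, v⟫_ℂ = (R : ℂ) := by
    rw [hv, inner_sum, hR, Complex.ofReal_sum]
    refine Finset.sum_congr rfl fun k _ => ?_
    rw [inner_smul_right, show a k = ⟪e k, f l⟫_ℂ / (m k : ℂ) from rfl,
      ← inner_conj_symm (e k) (f l), div_mul_eq_mul_div,
      Complex.conj_mul']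
    push_cast; rfl
  have h2 : ∑ j, ‖Y j v‖ ^ 2 = R := by
    rw [hv, he.sum_norm_sq_sum_smul, hR]
    refine Finset.sum_congr rfl fun k _ => ?_
    rw [show a k = ⟪e k, f l⟫_ℂ / (m k : ℂ) from rfl, norm_div, Complex.norm_real,
      Real.norm_of_nonneg (hm0 k), norm_inner_symm]
    change (_ / m k) ^ 2 * m k = _
    by_cases h0 : m k = 0
    · simp [h0]
    · field_simp
  have h3 : ‖Y i v‖ ^ 2 ≤ R := by
    rw [← h2]
    exact Finset.single_le_sum (f := fun j => ‖Y j v‖ ^ 2) (fun _ _ => sq_nonneg _)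
      (Finset.mem_univ i)
  have h4 : ‖Y i (f l)‖ ^ 2 * R ≤ ‖Y i (f l)‖ * ‖Y i v‖ := by
    have := norm_inner_le_norm (𝕜 := ℂ) (Y i (f l)) (Y i v)
    rwa [hf.inner_eq, h1, ← Complex.ofReal_mul, Complex.norm_real,
      Real.norm_of_nonneg (by positivity)] at this
  exact sq_mul_le_one_of_sq_mul_le_mul h4 hR0 h3

/-- The row sums of the matrix that takes the eigenvalues `∑ j, ‖Y j (e k)‖ ^ 2` of
`∑ j, (Y j)* (Y j)` to the squared singular values of all the `Y i`. -/
theorem IsGramEigenbasis.tsum_div_le_one (he : IsGramEigenbasis Y e) (i : ι)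
    {κ' : Type*} {f : HilbertBasis κ' ℂ H} (hf : IsSingularBasis (Y i) f) (l : κ') :
    ∑' k, ‖Y i (f l)‖ₑ ^ 2 * ‖⟪f l, e k⟫_ℂ‖ₑ ^ 2 / ∑ j, ‖Y j (e k)‖ₑ ^ 2 ≤ 1 := by
  refine ENNReal.summable.tsum_le_of_sum_le fun K => ?_
  rw [← ENNReal.ofReal_one]
  refine le_trans (Finset.sum_le_sum fun k _ => ?_)
    ((ENNReal.ofReal_sum_of_nonneg fun k _ => by positivity).symm.trans_le
      (ENNReal.ofReal_le_ofReal (he.sum_div_le_one i hf l K)))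
  by_cases h0 : ∑ j, ‖Y j (e k)‖ₑ ^ 2 = 0
  · have h1 : ‖Y i (e k)‖ₑ ^ 2 = 0 := (Finset.sum_eq_zero_iff.1 h0) i (Finset.mem_univ i)
    rw [← hf.tsum_enorm_sq_mul, ENNReal.tsum_eq_zero] at h1
    simp [h1 l]
  · have hsum : ∑ j, ‖Y j (e k)‖ₑ ^ 2 = ENNReal.ofReal (∑ j, ‖Y j (e k)‖ ^ 2) := by
      rw [ENNReal.ofReal_sum_of_nonneg fun _ _ => sq_nonneg _]
      simp only [enorm_sq_eq_ofReal]
    rw [hsum] at h0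
    rw [ENNReal.ofReal_div_of_pos (by simpa using h0), ENNReal.ofReal_mul (sq_nonneg _), hsum,
      enorm_sq_eq_ofReal, ENNReal.ofReal_pow (norm_nonneg _), ofReal_norm, enorm_eq_nnnorm,
      enorm_eq_nnnorm,
      ENNReal.ofReal_pow (norm_nonneg _), ofReal_norm, enorm_eq_nnnorm]

/-- Where the denominator vanishes, so does the numerator. -/
theorem IsGramEigenbasis.div_mul_cancel (i : ι)
    {κ' : Type*} {f : HilbertBasis κ' ℂ H} (hf : IsSingularBasis (Y i) f) (l : κ') (k : κ) :
    ‖Y i (f l)‖ₑ ^ 2 * ‖⟪f l, e k⟫_ℂ‖ₑ ^ 2 / (∑ j, ‖Y j (e k)‖ₑ ^ 2) * ∑ j, ‖Y j (e k)‖ₑ ^ 2 =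
      ‖Y i (f l)‖ₑ ^ 2 * ‖⟪f l, e k⟫_ℂ‖ₑ ^ 2 := by
  refine ENNReal.div_mul_cancel' (fun h0 => ?_) (fun h => ?_)
  · have h1 : ‖Y i (e k)‖ₑ ^ 2 = 0 := (Finset.sum_eq_zero_iff.1 h0) i (Finset.mem_univ i)
    rw [← hf.tsum_enorm_sq_mul, ENNReal.tsum_eq_zero] at h1
    exact h1 l
  · simp [ENNReal.sum_eq_top] at h

variable {κ' : ι → Type*} {f : ∀ i, HilbertBasis (κ' i) ℂ H}

/-- The inequality `∑ tr |Y i| ^ p ≤ tr (∑ |Y i| ^ 2) ^ (p / 2)`. -/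
theorem IsGramEigenbasis.sum_tsum_le (he : IsGramEigenbasis Y e)
    (hf : ∀ i, IsSingularBasis (Y i) (f i)) {p : ℝ} (hp : 2 ≤ p) :
    ∑ i, ∑' l, ‖Y i (f i l)‖ₑ ^ p ≤ ∑' k, (∑ i, ‖Y i (e k)‖ₑ ^ 2) ^ (p / 2) := by
  have h := ENNReal.tsum_rpow_tsum_mul_le (w := fun (x : Σ i, κ' i) k =>
      ‖Y x.1 (f x.1 x.2)‖ₑ ^ 2 * ‖⟪f x.1 x.2, e k⟫_ℂ‖ₑ ^ 2 / ∑ j, ‖Y j (e k)‖ₑ ^ 2)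
    (fun x => he.tsum_div_le_one x.1 (hf x.1) x.2)
    (fun k => by
      rw [ENNReal.tsum_sigma', tsum_fintype]
      simp only [div_eq_mul_inv, ENNReal.tsum_mul_right, (hf _).tsum_enorm_sq_mul]
      rw [← Finset.sum_mul]
      exact ENNReal.div_self_le_one)
    (fun k => ∑ i, ‖Y i (e k)‖ₑ ^ 2) (q := p / 2) (by linarith)
  simpa only [IsGramEigenbasis.div_mul_cancel _ (hf _), ENNReal.tsum_mul_left,
    e.tsum_enorm_inner_sq_right, HilbertBasis.enorm_apply, one_pow, mul_one, ENNReal.sq_rpow_half,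
    ENNReal.tsum_sigma', tsum_fintype] using h

/-- The concave counterpart of `IsGramEigenbasis.sum_tsum_le`. -/
theorem IsGramEigenbasis.le_sum_tsum (he : IsGramEigenbasis Y e)
    (hf : ∀ i, IsSingularBasis (Y i) (f i)) {p : ℝ} (hp0 : 0 < p) (hp : p ≤ 2) :
    ∑' k, (∑ i, ‖Y i (e k)‖ₑ ^ 2) ^ (p / 2) ≤ ∑ i, ∑' l, ‖Y i (f i l)‖ₑ ^ p := by
  have h := ENNReal.tsum_rpow_le_tsum_rpow_tsum_mul (w := fun (x : Σ i, κ' i) k =>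
      ‖Y x.1 (f x.1 x.2)‖ₑ ^ 2 * ‖⟪f x.1 x.2, e k⟫_ℂ‖ₑ ^ 2 / ∑ j, ‖Y j (e k)‖ₑ ^ 2)
    (fun x => he.tsum_div_le_one x.1 (hf x.1) x.2)
    (x := fun k => ∑ i, ‖Y i (e k)‖ₑ ^ 2)
    (fun k hk => by
      rw [ENNReal.tsum_sigma', tsum_fintype]
      simp only [div_eq_mul_inv, ENNReal.tsum_mul_right, (hf _).tsum_enorm_sq_mul]
      rw [← Finset.sum_mul, ENNReal.mul_inv_cancel hk (by simp [ENNReal.sum_eq_top])])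
    (q := p / 2) (by linarith) (by linarith)
  simpa only [IsGramEigenbasis.div_mul_cancel _ (hf _), ENNReal.tsum_mul_left,
    e.tsum_enorm_inner_sq_right, HilbertBasis.enorm_apply, one_pow, mul_one, ENNReal.sq_rpow_half,
    ENNReal.tsum_sigma', tsum_fintype] using h

end Gram

/-! ### Schatten sums -/

/-- The sum of the `p`-th powers of the singular values of `T`, as an extended nonnegative real. -/
noncomputable def schattenSum (p : ℝ) (T : H →L[ℂ] H) : ℝ≥0∞ :=
  ∑' n, ENNReal.ofReal (singularValue T n ^ p)

theorem mem_schattenClass_iff {p : ℝ} {T : H →L[ℂ] H} :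
    T ∈ schattenClass H p ↔ IsCompactOperator T ∧ schattenSum p T ≠ ∞ := by
  refine and_congr_right fun _ => ⟨fun h => ?_, fun h => ?_⟩
  · rw [schattenSum, ← ENNReal.ofReal_tsum_of_nonneg
      (fun n => Real.rpow_nonneg (singularValue_nonneg T n) p) h]
    exact ENNReal.ofReal_ne_top
  · refine (ENNReal.summable_toReal h).congr fun n => ?_
    exact ENNReal.toReal_ofReal (Real.rpow_nonneg (singularValue_nonneg T n) p)

theorem schattenNorm_rpow {p : ℝ} (hp : 0 < p) (T : H →L[ℂ] H) :
    schattenNorm p T ^ p = (schattenSum p T).toReal := by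
  have h0 := fun n => Real.rpow_nonneg (singularValue_nonneg T n) p
  rw [schattenNorm, ← Real.rpow_mul (tsum_nonneg h0), one_div_mul_cancel hp.ne', Real.rpow_one,
    schattenSum, ENNReal.tsum_toReal_eq fun _ => ENNReal.ofReal_ne_top]
  simp only [ENNReal.toReal_ofReal (h0 _)]

theorem sum_schattenSum_le {ι : Type*} [Fintype ι] {X Y : ι → H →L[ℂ] H}
    (hX : ∀ i, IsCompactOperator (X i)) (hY : ∀ i, IsCompactOperator (Y i))
    (hXY : ∀ x, ∑ i, ‖Y i x‖ ^ 2 = ∑ i, ‖X i x‖ ^ 2) {p : ℝ} (hp : 2 ≤ p) :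
    ∑ i, schattenSum p (Y i) ≤
      (Fintype.card ι : ℝ≥0∞) ^ (p / 2 - 1) * ∑ i, schattenSum p (X i) := by
  have hp0 : 0 < p := by linarith
  obtain ⟨κ, e, he⟩ := exists_isGramEigenbasis hY
  choose κX f hf using fun i => exists_isSingularBasis (hX i)
  choose κY g hg using fun i => exists_isSingularBasis (hY i)
  have hXY' : ∀ x, ∑ i, ‖Y i x‖ₑ ^ 2 = ∑ i, ‖X i x‖ₑ ^ 2 := fun x => by
    simp only [enorm_sq_eq_ofReal, ← ENNReal.ofReal_sum_of_nonneg fun _ _ => sq_nonneg _, hXY]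
  simp only [schattenSum, (hf _).tsum_singularValue_rpow (hX _) hp0,
    (hg _).tsum_singularValue_rpow (hY _) hp0]
  calc _ ≤ ∑' k, (∑ i, ‖Y i (e k)‖ₑ ^ 2) ^ (p / 2) := he.sum_tsum_le hg hp
    _ = ∑' k, (∑ i, ‖X i (e k)‖ₑ ^ 2) ^ (p / 2) := by simp only [hXY']
    _ ≤ ∑' k, (Fintype.card ι : ℝ≥0∞) ^ (p / 2 - 1) * ∑ i, ‖X i (e k)‖ₑ ^ p := by
        refine ENNReal.tsum_le_tsum fun k => ?_
        have := ENNReal.rpow_sum_le_const_mul_sum_rpow Finset.univ (fun i => ‖X i (e k)‖ₑ ^ 2)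
          (show 1 ≤ p / 2 by linarith)
        simpa only [ENNReal.sq_rpow_half, Finset.card_univ] using this
    _ = (Fintype.card ι : ℝ≥0∞) ^ (p / 2 - 1) * ∑ i, ∑' k, ‖X i (e k)‖ₑ ^ p := by
        rw [ENNReal.tsum_mul_left, Summable.tsum_finsetSum fun _ _ => ENNReal.summable]
    _ ≤ _ := by
        gcongr with i
        exact (hf i).tsum_enorm_rpow_le e hp

theorem le_sum_schattenSum {ι : Type*} [Fintype ι] [Nonempty ι] {X Y : ι → H →L[ℂ] H}
    (hX : ∀ i, IsCompactOperator (X i)) (hY : ∀ i, IsCompactOperator (Y i))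
    (hXY : ∀ x, ∑ i, ‖Y i x‖ ^ 2 = ∑ i, ‖X i x‖ ^ 2) {p : ℝ} (hp0 : 0 < p) (hp : p ≤ 2) :
    (Fintype.card ι : ℝ≥0∞) ^ (p / 2 - 1) * ∑ i, schattenSum p (X i) ≤
      ∑ i, schattenSum p (Y i) := by
  obtain ⟨κ, e, he⟩ := exists_isGramEigenbasis hY
  choose κX f hf using fun i => exists_isSingularBasis (hX i)
  choose κY g hg using fun i => exists_isSingularBasis (hY i)
  have hXY' : ∀ x, ∑ i, ‖Y i x‖ₑ ^ 2 = ∑ i, ‖X i x‖ₑ ^ 2 := fun x => by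
    simp only [enorm_sq_eq_ofReal, ← ENNReal.ofReal_sum_of_nonneg fun _ _ => sq_nonneg _, hXY]
  simp only [schattenSum, (hf _).tsum_singularValue_rpow (hX _) hp0,
    (hg _).tsum_singularValue_rpow (hY _) hp0]
  calc _ ≤ (Fintype.card ι : ℝ≥0∞) ^ (p / 2 - 1) * ∑ i, ∑' k, ‖X i (e k)‖ₑ ^ p := by
        gcongr with i
        exact (hf i).le_tsum_enorm_rpow e hp0 hp
    _ = ∑' k, (Fintype.card ι : ℝ≥0∞) ^ (p / 2 - 1) * ∑ i, ‖X i (e k)‖ₑ ^ p := by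
        rw [ENNReal.tsum_mul_left, Summable.tsum_finsetSum fun _ _ => ENNReal.summable]
    _ ≤ ∑' k, (∑ i, ‖X i (e k)‖ₑ ^ 2) ^ (p / 2) := by
        refine ENNReal.tsum_le_tsum fun k => ?_
        have := ENNReal.sum_rpow_le_const_mul_rpow_sum Finset.univ Finset.univ_nonempty
          (fun i => ‖X i (e k)‖ₑ ^ 2) (show 0 < p / 2 by linarith) (by linarith)
        simpa only [ENNReal.sq_rpow_half, Finset.card_univ] using this
    _ = ∑' k, (∑ i, ‖Y i (e k)‖ₑ ^ 2) ^ (p / 2) := by simp only [hXY']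
    _ ≤ _ := he.le_sum_tsum hg hp0 hp

theorem schattenSum_smul {T : H →L[ℂ] H} (hT : IsCompactOperator T) (c : ℂ) {p : ℝ} (hp : 0 < p) :
    schattenSum p (c • T) = ‖c‖ₑ ^ p * schattenSum p T := by
  obtain ⟨κ, e, he⟩ := exists_isSingularBasis hT
  have he' : IsSingularBasis (c • T) e := fun k => by
    have : adjoint (c • T) = (starRingEnd ℂ) c • adjoint T := map_smulₛₗ _ _ _
    rw [this, smul_apply, smul_apply, map_smul, he k, smul_smul, smul_smul, Complex.conj_mul',
      norm_smul]
    push_cast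
    ring_nf
  rw [schattenSum, schattenSum, he.tsum_singularValue_rpow hT hp,
    he'.tsum_singularValue_rpow (hT.smul c) hp, ← ENNReal.tsum_mul_left]
  refine tsum_congr fun k => ?_
  rw [smul_apply, enorm_smul, ENNReal.mul_rpow_of_nonneg _ _ hp.le]

theorem schattenSum_ne_zero {T : H →L[ℂ] H} (hT : IsCompactOperator T) (h : T ≠ 0) {p : ℝ}
    (hp : 0 < p) : schattenSum p T ≠ 0 := by
  obtain ⟨κ, e, he⟩ := exists_isSingularBasis hT
  rw [schattenSum, he.tsum_singularValue_rpow hT hp]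
  contrapose! h
  rw [ENNReal.tsum_eq_zero] at h
  ext x
  have hk : ∀ k, ‖T (e k)‖ₑ = 0 := fun k => (ENNReal.rpow_eq_zero_iff_of_pos hp).1 (h k)
  have := he.tsum_enorm_sq_mul x
  simpa [hk] using this.symm

theorem schattenSum_zero {p : ℝ} (hp : 0 < p) : schattenSum p (0 : H →L[ℂ] H) = 0 := by
  simpa [ENNReal.zero_rpow_of_pos hp] using
    schattenSum_smul (H := H) (T := 0) isCompactOperator_zero 0 hp

theorem ENNReal.four_rpow (p : ℝ) : (4 : ℝ≥0∞) ^ (p / 2 - 1) = 2 ^ (p - 2) := by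
  rw [show (4 : ℝ≥0∞) = 2 ^ (2 : ℝ) by norm_num, ← ENNReal.rpow_mul]
  congr 1; ring

/-! ### Quadruples of operators and closure under addition -/

section Four

variable {X₀ X₁ X₂ X₃ Y₀ Y₁ Y₂ Y₃ : H →L[ℂ] H}
  (hX₀ : IsCompactOperator X₀) (hX₁ : IsCompactOperator X₁)
  (hX₂ : IsCompactOperator X₂) (hX₃ : IsCompactOperator X₃)
  (hY₀ : IsCompactOperator Y₀) (hY₁ : IsCompactOperator Y₁)
  (hY₂ : IsCompactOperator Y₂) (hY₃ : IsCompactOperator Y₃)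
  (h : ∀ x, ‖Y₀ x‖ ^ 2 + ‖Y₁ x‖ ^ 2 + ‖Y₂ x‖ ^ 2 + ‖Y₃ x‖ ^ 2 =
    ‖X₀ x‖ ^ 2 + ‖X₁ x‖ ^ 2 + ‖X₂ x‖ ^ 2 + ‖X₃ x‖ ^ 2)
include hX₀ hX₁ hX₂ hX₃ hY₀ hY₁ hY₂ hY₃ h

theorem schattenSum_four_le {p : ℝ} (hp : 2 ≤ p) :
    schattenSum p Y₀ + schattenSum p Y₁ + schattenSum p Y₂ + schattenSum p Y₃ ≤
      2 ^ (p - 2) *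
        (schattenSum p X₀ + schattenSum p X₁ + schattenSum p X₂ + schattenSum p X₃) := by
  have := sum_schattenSum_le (ι := Fin 4) (X := ![X₀, X₁, X₂, X₃]) (Y := ![Y₀, Y₁, Y₂, Y₃])
    (by rw [Fin.forall_fin_succ, Fin.forall_fin_succ, Fin.forall_fin_two]
        exact ⟨hX₀, hX₁, hX₂, hX₃⟩)
    (by rw [Fin.forall_fin_succ, Fin.forall_fin_succ, Fin.forall_fin_two]
        exact ⟨hY₀, hY₁, hY₂, hY₃⟩)
    (fun x => by rw [Fin.sum_univ_four, Fin.sum_univ_four]; exact h x) hp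
  rw [Fin.sum_univ_four, Fin.sum_univ_four, Fintype.card_fin, Nat.cast_ofNat,
    ENNReal.four_rpow] at this
  exact this

theorem le_schattenSum_four {p : ℝ} (hp0 : 0 < p) (hp : p ≤ 2) :
    2 ^ (p - 2) * (schattenSum p X₀ + schattenSum p X₁ + schattenSum p X₂ + schattenSum p X₃) ≤
      schattenSum p Y₀ + schattenSum p Y₁ + schattenSum p Y₂ + schattenSum p Y₃ := by
  have := le_sum_schattenSum (ι := Fin 4) (X := ![X₀, X₁, X₂, X₃]) (Y := ![Y₀, Y₁, Y₂, Y₃])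
    (by rw [Fin.forall_fin_succ, Fin.forall_fin_succ, Fin.forall_fin_two]
        exact ⟨hX₀, hX₁, hX₂, hX₃⟩)
    (by rw [Fin.forall_fin_succ, Fin.forall_fin_succ, Fin.forall_fin_two]
        exact ⟨hY₀, hY₁, hY₂, hY₃⟩)
    (fun x => by rw [Fin.sum_univ_four, Fin.sum_univ_four]; exact h x) hp0 hp
  rw [Fin.sum_univ_four, Fin.sum_univ_four, Fintype.card_fin, Nat.cast_ofNat,
    ENNReal.four_rpow] at this
  exact this

end Four

theorem add_mem_schattenClass {p : ℝ} (hp : 0 < p) {A B : H →L[ℂ] H} (hA : A ∈ schattenClass H p)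
    (hB : B ∈ schattenClass H p) : A + B ∈ schattenClass H p := by
  rw [mem_schattenClass_iff] at *
  obtain ⟨hA, hA'⟩ := hA
  obtain ⟨hB, hB'⟩ := hB
  refine ⟨hA.add hB, ?_⟩
  have h0 : IsCompactOperator (0 : H →L[ℂ] H) := isCompactOperator_zero
  have h : ∀ x, ‖(A + B) x‖ ^ 2 + ‖(A - B) x‖ ^ 2 + ‖(0 : H →L[ℂ] H) x‖ ^ 2 +
      ‖(0 : H →L[ℂ] H) x‖ ^ 2 = ‖A x‖ ^ 2 + ‖A x‖ ^ 2 + ‖B x‖ ^ 2 + ‖B x‖ ^ 2 := fun x => by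
    have := parallelogram_law_with_norm ℂ (A x) (B x)
    rw [zero_apply, norm_zero, add_apply, sub_apply]
    linarith
  have hc : (2 : ℝ≥0∞) ^ (p - 2) ≠ 0 := by simp
  have hc' : (2 : ℝ≥0∞) ^ (p - 2) ≠ ∞ := by simp
  have hfin : schattenSum p A + schattenSum p A + schattenSum p B + schattenSum p B ≠ ∞ := by
    simp [hA', hB']
  have hY : schattenSum p (A + B) + schattenSum p (A - B) + schattenSum p (0 : H →L[ℂ] H) +
      schattenSum p (0 : H →L[ℂ] H) ≠ ∞ := by
    rcases le_total 2 p with h2 | h2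
    · exact ne_top_of_le_ne_top (ENNReal.mul_ne_top hc' hfin)
        (schattenSum_four_le hA hA hB hB (hA.add hB) (hA.sub hB) h0 h0 h h2)
    -- Here the roles of the two families are exchanged.
    · intro htop
      have := le_schattenSum_four (hA.add hB) (hA.sub hB) h0 h0 hA hA hB hB
        (fun x => (h x).symm) hp h2
      rw [htop, ENNReal.mul_top hc] at this
      exact hfin (top_le_iff.1 this)
  simp only [ne_eq, ENNReal.add_eq_top, not_or] at hY
  exact hY.1.1.1

theorem neg_mem_schattenClass {p : ℝ} (hp : 0 < p) {A : H →L[ℂ] H} (hA : A ∈ schattenClass H p) :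
    -A ∈ schattenClass H p := by
  rw [mem_schattenClass_iff] at *
  refine ⟨hA.1.neg, ?_⟩
  have := schattenSum_smul hA.1 (-1) hp
  rw [neg_one_smul] at this
  rw [this]
  simpa using hA.2

/-- Witnessed by the orthogonal projection onto a line. -/
theorem exists_mem_schattenClass_ne_zero [Nontrivial H] {p : ℝ} (hp : 0 < p) :
    ∃ A ∈ schattenClass H p, A ≠ 0 := by
  obtain ⟨u, hu⟩ := exists_norm_eq H zero_le_one
  have hu0 : u ≠ 0 := fun h => by simp [h] at hu
  let A : H →L[ℂ] H := (innerSL ℂ u).smulRight u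
  have hAx : ∀ x, A x = ⟪u, x⟫_ℂ • u := fun x => rfl
  have hAc : IsCompactOperator A :=
    (isCompactOperator_of_locallyCompactSpace_rng
      (toSpanSingleton ℂ u)).comp_clm (innerSL ℂ u)
  refine ⟨A, mem_schattenClass_iff.2 ⟨hAc, ?_⟩, fun h => ?_⟩
  · obtain ⟨κ, e, he⟩ := exists_isSingularBasis hAc
    have hn : ∀ x, ‖A x‖ = ‖⟪u, x⟫_ℂ‖ := fun x => by rw [hAx, norm_smul, hu, mul_one]
    have hfin := he.finite_le_norm hAc one_pos
    -- `A` is a projection, so all its singular values are `0` or `1`.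
    have h01 : ∀ k, ¬ 1 ≤ ‖A (e k)‖ → A (e k) = 0 := fun k hk => by
      have h1 := congrArg norm (he.inner_eq k u)
      rw [show A u = u by rw [hAx, inner_self_eq_norm_sq_to_K, hu]; simp, hAx, inner_smul_left,
        inner_self_eq_norm_sq_to_K, hu, norm_smul, hu, norm_mul, norm_mul, RCLike.norm_conj,
        norm_inner_symm (e k) u, Complex.norm_real, Real.norm_of_nonneg (sq_nonneg _)] at h1
      simp only [hn, RCLike.ofReal_one, one_pow, norm_one, mul_one, not_le] at h1 hk
      have h2 : ‖⟪u, e k⟫_ℂ‖ = 0 := by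
        by_contra hne
        have hpos := lt_of_le_of_ne (norm_nonneg ⟪u, e k⟫_ℂ) (Ne.symm hne)
        nlinarith [mul_lt_mul_of_pos_left hk hpos]
      rw [hAx, norm_eq_zero.1 h2, zero_smul]
    rw [schattenSum, he.tsum_singularValue_rpow hAc hp, tsum_eq_sum (s := hfin.toFinset)]
    · exact (ENNReal.sum_lt_top.2 fun k _ => ENNReal.rpow_lt_top_of_nonneg hp.le enorm_ne_top).ne
    · intro k hk
      rw [h01 k (by simpa using hk)]
      simp [ENNReal.zero_rpow_of_pos hp]
  · have := hAx u
    rw [h, zero_apply, inner_self_eq_norm_sq_to_K, hu] at this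
    simp at this
    exact hu0 this.symm

/-! ### The inequality, its equality case and optimality -/

/-- Hlawka's identity. -/
theorem norm_sq_add_pairs {E : Type*} [NormedAddCommGroup E] [InnerProductSpace ℂ E] (a b c : E) :
    ‖a + b‖ ^ 2 + ‖b + c‖ ^ 2 + ‖c + a‖ ^ 2 = ‖a + b + c‖ ^ 2 + ‖a‖ ^ 2 + ‖b‖ ^ 2 + ‖c‖ ^ 2 := by
  simp only [@norm_add_sq ℂ, inner_add_left, map_add]
  rw [← inner_re_symm (𝕜 := ℂ) a c]
  ring

theorem two_rpow_toReal (p : ℝ) : ((2 : ℝ≥0∞) ^ (p - 2)).toReal = (2 : ℝ) ^ (p - 2) := by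
  rw [← ENNReal.toReal_rpow]; rfl

theorem toReal_add_four {a b c d : ℝ≥0∞} (ha : a ≠ ∞) (hb : b ≠ ∞) (hc : c ≠ ∞) (hd : d ≠ ∞) :
    (a + b + c + d).toReal = a.toReal + b.toReal + c.toReal + d.toReal := by
  rw [ENNReal.toReal_add (by simp [*]) hd, ENNReal.toReal_add (by simp [*]) hc,
    ENNReal.toReal_add ha hb]

section Triple

variable {p : ℝ} {A B C : H →L[ℂ] H}

theorem norm_sq_apply_pairs {H : Type*} [NormedAddCommGroup H] [InnerProductSpace ℂ H]
    (A B C : H →L[ℂ] H) (x : H) :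
    ‖(A + B) x‖ ^ 2 + ‖(B + C) x‖ ^ 2 + ‖(C + A) x‖ ^ 2 + ‖(0 : H →L[ℂ] H) x‖ ^ 2 =
      ‖(A + B + C) x‖ ^ 2 + ‖A x‖ ^ 2 + ‖B x‖ ^ 2 + ‖C x‖ ^ 2 := by
  have := norm_sq_add_pairs (A x) (B x) (C x)
  simpa only [zero_apply, norm_zero, add_apply, ne_eq, OfNat.ofNat_ne_zero, not_false_eq_true,
    zero_pow, add_zero] using this

theorem schattenNorm_hlawka (hp : 2 ≤ p) (hA : A ∈ schattenClass H p) (hB : B ∈ schattenClass H p)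
    (hC : C ∈ schattenClass H p) :
    schattenNorm p (A + B) ^ p + schattenNorm p (B + C) ^ p + schattenNorm p (C + A) ^ p ≤
      (2 : ℝ) ^ (p - 2) * (schattenNorm p (A + B + C) ^ p + schattenNorm p A ^ p +
        schattenNorm p B ^ p + schattenNorm p C ^ p) := by
  have hp0 : 0 < p := by linarith
  have hAB := mem_schattenClass_iff.1 (add_mem_schattenClass hp0 hA hB)
  have hBC := mem_schattenClass_iff.1 (add_mem_schattenClass hp0 hB hC)
  have hCA := mem_schattenClass_iff.1 (add_mem_schattenClass hp0 hC hA)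
  have hABC := mem_schattenClass_iff.1
    (add_mem_schattenClass hp0 (add_mem_schattenClass hp0 hA hB) hC)
  rw [mem_schattenClass_iff] at hA hB hC
  have h := schattenSum_four_le hABC.1 hA.1 hB.1 hC.1 hAB.1 hBC.1 hCA.1 isCompactOperator_zero
    (norm_sq_apply_pairs A B C) hp
  have h' := ENNReal.toReal_mono (ENNReal.mul_ne_top (by simp)
    (by simp [hABC.2, hA.2, hB.2, hC.2])) h
  rw [schattenSum_zero hp0, toReal_add_four hAB.2 hBC.2 hCA.2 ENNReal.zero_ne_top,
    ENNReal.toReal_mul, toReal_add_four hABC.2 hA.2 hB.2 hC.2, two_rpow_toReal,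
    ENNReal.toReal_zero, add_zero] at h'
  simpa only [schattenNorm_rpow hp0] using h'

theorem schattenNorm_hlawka_reverse (hp0 : 0 < p) (hp : p ≤ 2) (hA : A ∈ schattenClass H p)
    (hB : B ∈ schattenClass H p) (hC : C ∈ schattenClass H p) :
    (2 : ℝ) ^ (p - 2) * (schattenNorm p (A + B + C) ^ p + schattenNorm p A ^ p +
        schattenNorm p B ^ p + schattenNorm p C ^ p) ≤
      schattenNorm p (A + B) ^ p + schattenNorm p (B + C) ^ p + schattenNorm p (C + A) ^ p := by
  have hAB := mem_schattenClass_iff.1 (add_mem_schattenClass hp0 hA hB)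
  have hBC := mem_schattenClass_iff.1 (add_mem_schattenClass hp0 hB hC)
  have hCA := mem_schattenClass_iff.1 (add_mem_schattenClass hp0 hC hA)
  have hABC := mem_schattenClass_iff.1
    (add_mem_schattenClass hp0 (add_mem_schattenClass hp0 hA hB) hC)
  rw [mem_schattenClass_iff] at hA hB hC
  have h := le_schattenSum_four hABC.1 hA.1 hB.1 hC.1 hAB.1 hBC.1 hCA.1 isCompactOperator_zero
    (norm_sq_apply_pairs A B C) hp0 hp
  rw [schattenSum_zero hp0] at h
  have h' := ENNReal.toReal_mono (by simp [hAB.2, hBC.2, hCA.2]) h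
  rw [toReal_add_four hAB.2 hBC.2 hCA.2 ENNReal.zero_ne_top,
    ENNReal.toReal_mul, toReal_add_four hABC.2 hA.2 hB.2 hC.2, two_rpow_toReal,
    ENNReal.toReal_zero, add_zero] at h'
  simpa only [schattenNorm_rpow hp0] using h'

theorem schattenNorm_smul_rpow (hp : 0 < p) (hA : IsCompactOperator A) (c : ℂ) :
    schattenNorm p (c • A) ^ p = ‖c‖ ^ p * schattenNorm p A ^ p := by
  rw [schattenNorm_rpow hp, schattenNorm_rpow hp, schattenSum_smul hA c hp, ENNReal.toReal_mul,
    ← ENNReal.toReal_rpow, toReal_enorm]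

/-- The equality case: for `A, A, -A` two of the pair sums vanish, and the other one is `2 A`. -/
theorem schattenNorm_hlawka_eq (hp : 0 < p) (hA : A ∈ schattenClass H p) (h0 : A ≠ 0) :
    schattenNorm p (A + A) ^ p + schattenNorm p (A + -A) ^ p + schattenNorm p (-A + A) ^ p =
      (2 : ℝ) ^ (p - 2) * (schattenNorm p (A + A + -A) ^ p + schattenNorm p A ^ p +
        schattenNorm p A ^ p + schattenNorm p (-A) ^ p) ∧
    0 < schattenNorm p (A + A) ^ p + schattenNorm p (A + -A) ^ p +
      schattenNorm p (-A + A) ^ p := by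
  rw [mem_schattenClass_iff] at hA
  have h2 : schattenNorm p (A + A) ^ p = 2 ^ p * schattenNorm p A ^ p := by
    rw [← two_smul ℂ A, schattenNorm_smul_rpow hp hA.1]; simp
  have hn : schattenNorm p (-A) ^ p = schattenNorm p A ^ p := by
    rw [← neg_one_smul ℂ A, schattenNorm_smul_rpow hp hA.1]; simp
  have hz : schattenNorm p (0 : H →L[ℂ] H) ^ p = 0 := by
    rw [schattenNorm_rpow hp, schattenSum_zero hp, ENNReal.toReal_zero]
  have hpos : 0 < schattenNorm p A ^ p := by
    rw [schattenNorm_rpow hp]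
    exact ENNReal.toReal_pos (schattenSum_ne_zero hA.1 h0 hp) hA.2
  rw [add_neg_cancel, neg_add_cancel, add_neg_cancel_right, h2, hn, hz]
  refine ⟨?_, by positivity⟩
  rw [Real.rpow_sub two_pos, Real.rpow_two]
  ring

end Triple

end

theorem theorem1p12 {H : Type*} [NormedAddCommGroup H] [InnerProductSpace ℂ H] [CompleteSpace H] :
    -- the sums below lie in `S_p`, so that all the (quasi)norms below are finite
    (∀ p : ℝ, 0 < p → ∀ A ∈ schattenClass H p, ∀ B ∈ schattenClass H p,
      A + B ∈ schattenClass H p) ∧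
    -- the inequality for `p ≥ 2`
    (∀ p : ℝ, 2 ≤ p →
      ∀ A ∈ schattenClass H p, ∀ B ∈ schattenClass H p, ∀ C ∈ schattenClass H p,
        schattenNorm p (A + B) ^ p + schattenNorm p (B + C) ^ p + schattenNorm p (C + A) ^ p ≤
          (2 : ℝ) ^ (p - 2) * (schattenNorm p (A + B + C) ^ p + schattenNorm p A ^ p +
            schattenNorm p B ^ p + schattenNorm p C ^ p)) ∧
    -- the reversed inequality for `0 < p ≤ 2`
    (∀ p : ℝ, 0 < p → p ≤ 2 →
      ∀ A ∈ schattenClass H p, ∀ B ∈ schattenClass H p, ∀ C ∈ schattenClass H p,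
        (2 : ℝ) ^ (p - 2) * (schattenNorm p (A + B + C) ^ p + schattenNorm p A ^ p +
            schattenNorm p B ^ p + schattenNorm p C ^ p) ≤
          schattenNorm p (A + B) ^ p + schattenNorm p (B + C) ^ p + schattenNorm p (C + A) ^ p) ∧
    -- equality for `A = B = -C ≠ 0`, where both sides are positive
    (∀ p : ℝ, 0 < p →
      ∀ A ∈ schattenClass H p, ∀ B ∈ schattenClass H p, ∀ C ∈ schattenClass H p,
        A = B → B = -C → A ≠ 0 →
        schattenNorm p (A + B) ^ p + schattenNorm p (B + C) ^ p + schattenNorm p (C + A) ^ p =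
          (2 : ℝ) ^ (p - 2) * (schattenNorm p (A + B + C) ^ p + schattenNorm p A ^ p +
            schattenNorm p B ^ p + schattenNorm p C ^ p) ∧
        0 < schattenNorm p (A + B) ^ p + schattenNorm p (B + C) ^ p +
          schattenNorm p (C + A) ^ p) ∧
    -- optimality of the constant for `p ≥ 2`: no smaller constant will do
    (Nontrivial H → ∀ p : ℝ, 2 ≤ p → ∀ c : ℝ,
      (∀ A ∈ schattenClass H p, ∀ B ∈ schattenClass H p, ∀ C ∈ schattenClass H p,
        schattenNorm p (A + B) ^ p + schattenNorm p (B + C) ^ p + schattenNorm p (C + A) ^ p ≤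
          c * (schattenNorm p (A + B + C) ^ p + schattenNorm p A ^ p +
            schattenNorm p B ^ p + schattenNorm p C ^ p)) →
      (2 : ℝ) ^ (p - 2) ≤ c) ∧
    -- optimality of the constant for `0 < p ≤ 2`: no larger constant will do
    (Nontrivial H → ∀ p : ℝ, 0 < p → p ≤ 2 → ∀ c : ℝ,
      (∀ A ∈ schattenClass H p, ∀ B ∈ schattenClass H p, ∀ C ∈ schattenClass H p,
        c * (schattenNorm p (A + B + C) ^ p + schattenNorm p A ^ p +
            schattenNorm p B ^ p + schattenNorm p C ^ p) ≤
          schattenNorm p (A + B) ^ p + schattenNorm p (B + C) ^ p + schattenNorm p (C + A) ^ p) →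
      c ≤ (2 : ℝ) ^ (p - 2)) := by
  refine ⟨fun p hp A hA B hB => add_mem_schattenClass hp hA hB,
    fun p hp A hA B hB C hC => schattenNorm_hlawka hp hA hB hC,
    fun p hp0 hp A hA B hB C hC => schattenNorm_hlawka_reverse hp0 hp hA hB hC, ?_, ?_, ?_⟩
  · intro p hp A hA B hB C hC hAB hBC h0
    obtain rfl : C = -A := by rw [hAB, hBC, neg_neg]
    subst hAB
    exact schattenNorm_hlawka_eq hp hA h0
  · intro _ p hp c hc
    have hp0 : 0 < p := by linarith
    obtain ⟨A, hA, h0⟩ := exists_mem_schattenClass_ne_zero (H := H) hp0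
    have h := hc A hA A hA (-A) (neg_mem_schattenClass hp0 hA)
    obtain ⟨heq, hpos⟩ := schattenNorm_hlawka_eq hp0 hA h0
    rw [heq] at h hpos
    exact le_of_mul_le_mul_right h (pos_of_mul_pos_right hpos (by positivity))
  · intro _ p hp0 hp c hc
    obtain ⟨A, hA, h0⟩ := exists_mem_schattenClass_ne_zero (H := H) hp0
    have h := hc A hA A hA (-A) (neg_mem_schattenClass hp0 hA)
    obtain ⟨heq, hpos⟩ := schattenNorm_hlawka_eq hp0 hA h0
    rw [heq] at h hpos
    exact le_of_mul_le_mul_right h (pos_of_mul_pos_right hpos (by positivity))
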